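/- All graphs are finite and simple. A graph is $(H_1,H_2,H_3)$-free if it has no induced subgraph isomorphic to any $H_i$. Let $P_7$ be the path on $7$ vertices and $C_4$ the cycle on $4$ vertices, and let the kite be the graph obtained from two triangles sharing exactly one edge by adding a further vertex adjacent to exactly one of the two vertices that do not lie on the shared edge, and to no other vertex. Write $\delta(G)$ for the minimum degree and $\omega(G)$ for the clique number of $G$. A clique cutset of $G$ is a clique $K$ such that $G-K$ has more connected components than $G$. For graphs $A$ and $B$ on disjoint vertex sets, $A+B$ denotes the complete join, that is, the disjoint union of $A$ and $B$ together with all edges between $V(A)$ and $V(B)$; $K_0$ is the graph without vertices. Let $F$ be the graph obtained from a cycle $v_1v_2v_3v_4v_5v_6v_7v_1$ by adding three pairwise non-adjacent vertices $y_1,y_2,y_3$, where $y_1$ is adjacent to exactly $v_1,v_4,v_5$, $y_2$ to exactly $v_2,v_5,v_6$, and $y_3$ to exactly $v_3,v_6,v_7$. Theorem. Let $G$ be a connected $(P_7,C_4,\text{kite})$-free graph with $\delta(G)\ge\omega(G)+1$. If $G$ has no clique cutset, then there is an integer $\ell\ge 0$ such that $G$ is isomorphic to $K_\ell+H$, where $H$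 is the Petersen graph or $F$. -/

import Mathlib

/-- `G` is `H`-free: no induced subgraph of `G` is isomorphic to `H`. -/
def InducedFree {V W : Type*} (G : SimpleGraph V) (H : SimpleGraph W) : Prop :=
  ¬ H.IsIndContained G

/-- The complete join `G + H`: the disjoint union of `G` and `H` together with all edges between
the two parts. -/
def graphJoin {V W : Type*} (G : SimpleGraph V) (H : SimpleGraph W) : SimpleGraph (V ⊕ W) :=
  (G ⊕g H) ⊔ completeBipartiteGraph V W

/-- The kite: the diamond with triangles `0 1 2` and `1 2 3` (sharing the edge `1 2`), and a
further vertex `4` adjacent only to the vertex `3`, which has degree two in the diamond. -/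
def kite : SimpleGraph (Fin 5) :=
  SimpleGraph.fromEdgeSet {s(0, 1), s(0, 2), s(1, 2), s(1, 3), s(2, 3), s(3, 4)}

/-- The Petersen graph: the vertices are the two-element subsets of a five-element set, and two of
them are adjacent when they are disjoint. -/
def petersenGraph : SimpleGraph {s : Finset (Fin 5) // s.card = 2} where
  Adj s t := Disjoint s.1 t.1
  symm := ⟨fun _ _ h => h.symm⟩
  loopless := ⟨fun s h => by
    have h0 : s.1 = ∅ := by simpa using h
    have h2 := s.2
    simp [h0] at h2⟩

/-- The neighbours in the 7-cycle `v₁ v₂ … v₇` of the three additional vertices `y₁, y₂, y₃` of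
the graph `F`. Here `vᵢ` is the element `i - 1` of `Fin 7` and `yᵢ` the element `i - 1` of
`Fin 3`. -/
def graphFNeighbors : Fin 3 → Finset (Fin 7) :=
  ![{0, 3, 4}, {1, 4, 5}, {2, 5, 6}]

/-- The graph `F`: a 7-cycle together with a stable set `{y₁, y₂, y₃}`, where `y₁` is adjacent to
`v₁, v₄, v₅`, `y₂` to `v₂, v₅, v₆`, and `y₃` to `v₃, v₆, v₇`. -/
def graphF : SimpleGraph (Fin 7 ⊕ Fin 3) where
  Adj
    | .inl i, .inl j => (SimpleGraph.cycleGraph 7).Adj i j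
    | .inl i, .inr k => i ∈ graphFNeighbors k
    | .inr k, .inl i => i ∈ graphFNeighbors k
    | .inr _, .inr _ => False
  symm := ⟨by
    rintro (i | k) (j | l) h
    · exact SimpleGraph.Adj.symm h
    · exact h
    · exact h
    · exact h⟩
  loopless := ⟨by
    rintro (i | k) h
    · exact (SimpleGraph.cycleGraph 7).irrefl h
    · exact h⟩

/-- A clique cutset of a graph `G`: a clique `K` such that `G - K` has more connected components
than `G`. (The graph is meant to be finite.) -/
def IsCliqueCutset {V : Type*} (G : SimpleGraph V) (K : Set V) : Prop :=
  G.IsClique K ∧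
    Nat.card G.ConnectedComponent < Nat.card (G.induce Kᶜ).ConnectedComponent

/-!

The proof shows more than the theorem asks for: only the Petersen graph occurs, as the clique
number and the minimum degree of `F` are both three.

A clique cutset can be found by local arguments whenever a diamond (two triangles `a b c` and `b c
d` with a common edge, `a` and `d` nonadjacent) is present and no vertex is universal. In a graph
without induced four-cycles and kites, every neighbour of `d` is adjacent to `b` or to `c`
(`IsKiteFreeAtom.adj_or_adj`). It follows first that a vertex whose closed neighbourhood contains
that of another vertex is universal (`IsKiteFreeAtom.universal_of_dominates`), then that there are
no diamonds in the absence of universal vertices (`IsKiteFreeAtom.adj_of_common`). So one removes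
the universal vertices, which form a clique joined completely to the rest, the `coreGraph`. The
core inherits all hypotheses, has no diamond, and since the degrees exceed the clique number, each
edge `v c` of the core leaves two neighbours of `v` that are neither `c` nor adjacent to `c`
(`IsKiteFreeAtom.isSparse_core`).

The rest is a finite search, however large the cliques are. Starting from an edge, one keeps
choosing a vertex `v` with a neighbour `c` such that at most one of the two further neighbours of
`v` is present, adds the missing one, and branches over its neighbourhood among the vertices
present; the branches with a four-cycle, a diamond or an induced path on seven vertices are cut
off. All branches die or reach the Petersen graph, and a vertex outside an induced Petersen graph
cannot have a neighbour in it. Both searches are run inside the kernel by `Pattern.search`, whose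
correctness is `Pattern.Realizes.exists_of_search`. Since the core is connected, it is the
Petersen graph.
-/

/-! ### Induced paths -/

/-- `l` lists the vertices of an induced path of `G`, in the order of the path. -/
def IsIndPath {V : Type*} (G : SimpleGraph V) : List V → Prop
  | [] => True
  | [_] => True
  | a :: b :: l => G.Adj a b ∧ (∀ c ∈ l, a ≠ c ∧ ¬ G.Adj a c) ∧ IsIndPath G (b :: l)

theorem IsIndPath.getElem {V : Type*} {G : SimpleGraph V} :
    ∀ {l : List V}, IsIndPath G l → ∀ (i j : ℕ) (hj : j < l.length) (hij : i < j),
      l[i] ≠ l[j] ∧ (G.Adj l[i] l[j] ↔ j = i + 1)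
  | [], _, _, _, hj, _ => by simp at hj
  | [_], _, i, j, hj, hij => by simp at hj; omega
  | a :: b :: l, h, 0, 1, _, _ => by simpa using ⟨h.1.ne, h.1⟩
  | a :: b :: l, h, 0, j + 2, hj, _ => by
    have := h.2.1 (l[j]'(by simpa using hj)) (List.getElem_mem _)
    simpa using this
  | a :: b :: l, h, i + 1, 0, hj, hij => by omega
  | a :: b :: l, h, i + 1, j + 1, hj, hij => by
    have := IsIndPath.getElem h.2.2 i j (by simpa using hj) (by omega)
    simpa using this

theorem IsIndPath.isIndContained {V : Type*} {G : SimpleGraph V} {l : List V}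
    (h : IsIndPath G l) : (SimpleGraph.pathGraph l.length).IsIndContained G := by
  have hinj : Function.Injective l.get := fun i j hij => by
    by_contra hne
    rcases lt_or_gt_of_ne hne with hlt | hlt
    · exact (h.getElem i j j.2 hlt).1 hij
    · exact (h.getElem j i i.2 hlt).1 hij.symm
  refine ⟨⟨⟨l.get, hinj⟩, fun {i j} => ?_⟩⟩
  change G.Adj l[i.val] l[j.val] ↔ _
  rw [SimpleGraph.pathGraph_adj]
  rcases lt_trichotomy i.val j.val with hlt | heq | hlt
  · rw [(h.getElem i j j.2 hlt).2]
    omega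
  · simp [heq]
  · rw [SimpleGraph.adj_comm, (h.getElem j i i.2 hlt).2]
    omega

/-- The local conditions that force a graph to contain the Petersen graph: two nonadjacent vertices
have at most one common neighbour, the common neighbours of two adjacent vertices form a clique,
each edge `v c` leaves at least two neighbours of `v` that are neither `c` nor adjacent to `c`, and
no induced path has seven vertices. -/
structure IsSparse {V : Type*} (G : SimpleGraph V) : Prop where
  eq_of_common : ∀ x y u w, x ≠ y → ¬ G.Adj x y → G.Adj x u → G.Adj y u → G.Adj x w → G.Adj y w →
    u = w
  adj_of_common : ∀ x y u w, G.Adj x y → G.Adj x u → G.Adj y u → G.Adj x w → G.Adj y w → u ≠ w →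
    G.Adj u w
  exists_two : ∀ v c, G.Adj v c → ∃ x y, x ≠ y ∧ (G.Adj v x ∧ x ≠ c ∧ ¬ G.Adj x c) ∧
    (G.Adj v y ∧ y ≠ c ∧ ¬ G.Adj y c)
  no_path : ∀ l : List V, IsIndPath G l → l.length ≠ 7

/-! ### Sets of small numbers as bit masks -/

namespace Pattern

/-- The difference of two sets of natural numbers given as bit masks. -/
def diff (a b : ℕ) : ℕ := Nat.xor a (Nat.land a b)

/-- Membership of `i` in the set with the bit mask `s`. -/
def mem (s i : ℕ) : Bool := Nat.beq (Nat.land (Nat.shiftRight s i) 1) 1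

/-- Whether a set given as a bit mask has at most one element. -/
def atMostOne (s : ℕ) : Bool := Nat.beq (diff s (Nat.pow 2 (Nat.log2 s))) 0

/-- Whether some element of the set with the bit mask `s` satisfies `p`; at most `k` elements are
tried, from the largest one on. -/
def anyMem (p : ℕ → Bool) : ℕ → ℕ → Bool
  | 0, _ => false
  | k + 1, s => bif Nat.beq s 0 then false else
      p (Nat.log2 s) || anyMem p k (diff s (Nat.pow 2 (Nat.log2 s)))

theorem testBit_land (a b i : ℕ) : (Nat.land a b).testBit i = (a.testBit i && b.testBit i) :=
  Nat.testBit_and a b i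

theorem testBit_lor (a b i : ℕ) : (Nat.lor a b).testBit i = (a.testBit i || b.testBit i) :=
  Nat.testBit_or a b i

theorem testBit_pow (n i : ℕ) : (Nat.pow 2 n).testBit i = decide (n = i) :=
  Nat.testBit_two_pow

theorem testBit_diff (a b i : ℕ) : (diff a b).testBit i = (a.testBit i && !b.testBit i) := by
  change (a ^^^ (a &&& b)).testBit i = _
  rw [Nat.testBit_xor, Nat.testBit_and]
  cases a.testBit i <;> cases b.testBit i <;> rfl

theorem mem_eq_testBit (s i : ℕ) : mem s i = s.testBit i := by
  rw [Nat.testBit_eq_decide_div_mod_eq]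
  change Nat.beq ((s >>> i) &&& 1) 1 = _
  rw [Nat.and_one_is_mod, Nat.shiftRight_eq_div_pow, Bool.eq_iff_iff]
  simp

theorem beq_zero_eq_false {s : ℕ} (h : Nat.beq s 0 = false) : ∃ i, s.testBit i = true :=
  Nat.exists_testBit_of_ne_zero (by rintro rfl; simp at h)

theorem atMostOne_eq_true {s i j : ℕ} (h : atMostOne s = true) (hi : s.testBit i = true)
    (hj : s.testBit j = true) : i = j := by
  have key : ∀ k, s.testBit k = true → Nat.log2 s = k := fun k hk => by
    have h0 : diff s (Nat.pow 2 (Nat.log2 s)) = 0 := Nat.eq_of_beq_eq_true h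
    have := testBit_diff s (Nat.pow 2 (Nat.log2 s)) k
    rw [h0, testBit_pow, hk] at this
    simpa using this
  rw [← key i hi, ← key j hj]

theorem atMostOne_eq_false {s : ℕ} (h : atMostOne s = false) :
    ∃ i j, i ≠ j ∧ s.testBit i = true ∧ s.testBit j = true := by
  obtain ⟨i, hi⟩ := beq_zero_eq_false h
  rw [testBit_diff, testBit_pow] at hi
  simp only [Bool.and_eq_true, Bool.not_eq_true', decide_eq_false_iff_not] at hi
  refine ⟨_, i, hi.2, Nat.testBit_log2 ?_, hi.1⟩
  rintro rfl
  simp at hi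

theorem anyMem_eq_true {p : ℕ → Bool} : ∀ {k s : ℕ}, anyMem p k s = true →
    ∃ i, s.testBit i = true ∧ p i = true
  | 0, _, h => by simp [anyMem] at h
  | k + 1, s, h => by
    rw [anyMem] at h
    cases h0 : Nat.beq s 0
    · rw [h0, cond_false, Bool.or_eq_true] at h
      rcases h with h | h
      · exact ⟨_, Nat.testBit_log2 (by rintro rfl; simp at h0), h⟩
      · obtain ⟨i, hi, hp⟩ := anyMem_eq_true h
        rw [testBit_diff, Bool.and_eq_true] at hi
        exact ⟨i, hi.1, hp⟩
    · simp [h0] at h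

/-! ### Patterns of small induced subgraphs -/

/-- The neighbours of the vertex `i` in the pattern `T`. A pattern on the vertices `0, …, n - 1`,
where `n ≤ 16`, is a number whose binary digit at the place `16 * i + j` tells whether `i` and `j`
are adjacent. -/
def row (T i : ℕ) : ℕ := Nat.land (Nat.shiftRight T (Nat.mul 16 i)) 65535

/-- The set `N`, as part of a column: the digit `i` of `N`, for `i < k`, is put at the place
`16 * i + n`. -/
def column (N n : ℕ) : ℕ → ℕ
  | 0 => 0
  | k + 1 => Nat.lor
      (Nat.shiftLeft (Nat.land (Nat.shiftRight N k) 1) (Nat.add (Nat.mul 16 k) n)) (column N n k)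

/-- The pattern `T` on `n` vertices, extended by a new vertex `n` with the set `N` of neighbours. -/
def extend (n T N : ℕ) : ℕ :=
  Nat.lor T (Nat.lor (Nat.shiftLeft N (Nat.mul 16 n)) (column N n n))

theorem testBit_row {T i j : ℕ} (hj : j < 16) : (row T i).testBit j = T.testBit (16 * i + j) := by
  change ((T >>> (16 * i)) &&& (2 ^ 16 - 1)).testBit j = _
  rw [Nat.testBit_and, Nat.testBit_two_pow_sub_one, Nat.testBit_shiftRight]
  simp [hj]

theorem testBit_column (N n p : ℕ) : ∀ k, (column N n k).testBit p = true ↔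
    ∃ i < k, N.testBit i = true ∧ p = 16 * i + n
  | 0 => by simp [column]
  | k + 1 => by
    have h1 : (Nat.shiftLeft (Nat.land (Nat.shiftRight N k) 1)
        (Nat.add (Nat.mul 16 k) n)).testBit p = true ↔ N.testBit k = true ∧ p = 16 * k + n := by
      change ((N >>> k &&& 1) <<< (16 * k + n)).testBit p = true ↔ _
      rw [Nat.testBit_shiftLeft, Nat.testBit_and, Nat.testBit_shiftRight]
      simp only [Bool.and_eq_true, decide_eq_true_eq, Nat.testBit_one_eq_true_iff_self_eq_zero]
      constructor
      · rintro ⟨h, h', h''⟩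
        rw [h''] at h'
        exact ⟨by simpa using h', by omega⟩
      · rintro ⟨h, rfl⟩
        simpa using h
    rw [column, testBit_lor, Bool.or_eq_true, h1, testBit_column N n p k]
    constructor
    · rintro (h | ⟨i, hi, h⟩)
      · exact ⟨k, by omega, h⟩
      · exact ⟨i, by omega, h⟩
    · rintro ⟨i, hi, h⟩
      rcases Nat.lt_succ_iff_lt_or_eq.mp hi with hi | rfl
      · exact Or.inr ⟨i, hi, h⟩
      · exact Or.inl h

theorem testBit_extend (n T N p : ℕ) : (extend n T N).testBit p = true ↔ T.testBit p = true ∨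
    (16 * n ≤ p ∧ N.testBit (p - 16 * n) = true) ∨
      ∃ i < n, N.testBit i = true ∧ p = 16 * i + n := by
  rw [extend, testBit_lor, testBit_lor, Bool.or_eq_true, Bool.or_eq_true, testBit_column]
  change _ ∨ ((N <<< (16 * n)).testBit p = true ∨ _) ↔ _
  rw [Nat.testBit_shiftLeft]
  simp

variable {V : Type*} {G : SimpleGraph V}

/-- The distinct vertices `f 0, …, f (n - 1)` induce the pattern `T` in `G`. -/
structure Realizes (G : SimpleGraph V) (n T : ℕ) (f : ℕ → V) : Prop where
  inj : ∀ i < n, ∀ j < n, f i = f j → i = j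
  adj : ∀ i < n, ∀ j < n, (T.testBit (16 * i + j) = true ↔ G.Adj (f i) (f j))

/-- No digit of `T` lies outside the places for pairs of vertices below `n`. -/
def Bounded (n T : ℕ) : Prop := ∀ p, T.testBit p = true → p / 16 < n ∧ p % 16 < n

/-- `N` is the set of neighbours of `x` among `f 0, …, f (n - 1)`. -/
structure IsTrace (G : SimpleGraph V) (n : ℕ) (f : ℕ → V) (x : V) (N : ℕ) : Prop where
  lt : N < 2 ^ n
  adj : ∀ i < n, (N.testBit i = true ↔ G.Adj x (f i))

theorem IsTrace.lt_of_testBit {n N i : ℕ} {f : ℕ → V} {x : V} (h : IsTrace G n f x N)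
    (hi : N.testBit i = true) : i < n := by
  by_contra hn
  have := Nat.testBit_lt_two_pow (lt_of_lt_of_le h.lt (Nat.pow_le_pow_right two_pos (not_lt.mp hn)))
  simp [this] at hi

theorem Realizes.testBit_row {n T i j : ℕ} {f : ℕ → V} (h : Realizes G n T f) (hn : n ≤ 16)
    (hi : i < n) (hj : j < n) : (row T i).testBit j = true ↔ G.Adj (f i) (f j) := by
  rw [Pattern.testBit_row (by omega), h.adj i hi j hj]

theorem Realizes.mono {n m T : ℕ} {f : ℕ → V} (h : Realizes G n T f) (hm : m ≤ n) :
    Realizes G m T f :=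
  ⟨fun i hi j hj => h.inj i (by omega) j (by omega),
    fun i hi j hj => h.adj i (by omega) j (by omega)⟩

theorem Bounded.extend {n T N : ℕ} (hT : Bounded n T) (hn : n < 16) (hN : N < 2 ^ n) :
    Bounded (n + 1) (extend n T N) := by
  intro p hp
  rw [testBit_extend] at hp
  rcases hp with hp | ⟨hle, hp⟩ | ⟨i, hi, -, rfl⟩
  · have := hT p hp
    omega
  · have : p - 16 * n < n := by
      by_contra hlt
      have := Nat.testBit_lt_two_pow
        (lt_of_lt_of_le hN (Nat.pow_le_pow_right two_pos (not_lt.mp hlt)))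
      simp [this] at hp
    omega
  · omega

theorem Realizes.extend {n T N : ℕ} {f : ℕ → V} (h : Realizes G n T f) (hT : Bounded n T)
    (hn : n < 16) (hx : ∀ i < n, f n ≠ f i) (hN : IsTrace G n f (f n) N) :
    Realizes G (n + 1) (extend n T N) f := by
  have hTn : ∀ i j, i ≤ n → j ≤ n → (i = n ∨ j = n) → T.testBit (16 * i + j) = false := by
    intro i j hi hj hij
    by_contra hb
    have := hT _ (by simpa using hb)
    omega
  refine ⟨fun i hi j hj hij => ?_, fun i hi j hj => ?_⟩
  · rcases Nat.lt_succ_iff_lt_or_eq.mp hi with hi | rfl <;>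
      rcases Nat.lt_succ_iff_lt_or_eq.mp hj with hj | rfl
    · exact h.inj i hi j hj hij
    · exact absurd hij.symm (hx i hi)
    · exact absurd hij (hx j hj)
    · rfl
  · rw [testBit_extend]
    rcases Nat.lt_succ_iff_lt_or_eq.mp hi with hi | rfl <;>
      rcases Nat.lt_succ_iff_lt_or_eq.mp hj with hj | rfl
    · rw [h.adj i hi j hj]
      constructor
      · rintro (h | h | ⟨k, hk, h⟩)
        · exact h
        · omega
        · omega
      · exact Or.inl
    · rw [hTn i j hi.le le_rfl (Or.inr rfl), SimpleGraph.adj_comm, ← hN.adj i hi]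
      constructor
      · rintro (h | h | ⟨k, hk, h, h'⟩)
        · simp at h
        · omega
        · obtain rfl : i = k := by omega
          exact h
      · exact fun h => Or.inr (Or.inr ⟨i, hi, h, rfl⟩)
    · rw [hTn i j le_rfl hj.le (Or.inl rfl), ← hN.adj j hj]
      constructor
      · rintro (h | ⟨-, h⟩ | ⟨k, hk, h, h'⟩)
        · simp at h
        · simpa using h
        · omega
      · exact fun h => Or.inr (Or.inl ⟨by omega, by simpa using h⟩)
    · rw [hTn _ _ le_rfl le_rfl (Or.inl rfl)]
      constructor
      · rintro (h | ⟨-, h⟩ | ⟨k, hk, h, h'⟩)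
        · simp at h
        · have := hN.lt_of_testBit h
          omega
        · omega
      · exact fun h => absurd h (G.irrefl)

/-! ### Searching for induced paths in a pattern -/

/-- Whether the vertex `a` of the pattern `T` is followed by `k` further vertices on an induced path
whose other vertices lie in `s`. -/
def hasPathFrom (T : ℕ) : ℕ → ℕ → ℕ → Bool
  | 0, _, _ => true
  | k + 1, a, s =>
    anyMem (fun w => hasPathFrom T k w (diff s (row T a))) 16 (Nat.land (row T a) s)

/-- Whether the pattern `T` on `n` vertices has an induced path with seven vertices. -/
def hasPath (n T : ℕ) : Bool :=
  anyMem (fun a => hasPathFrom T 6 a (diff (Nat.pow 2 n - 1) (Nat.pow 2 a))) 16 (Nat.pow 2 n - 1)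

theorem Realizes.exists_path_from {n T : ℕ} {f : ℕ → V} (h : Realizes G n T f) (hn : n ≤ 16) :
    ∀ (k a s : ℕ), hasPathFrom T k a s = true → a < n → (∀ i, s.testBit i = true → i < n) →
      s.testBit a = false →
      ∃ l : List V, l.length = k ∧ IsIndPath G (f a :: l) ∧
        ∀ c ∈ l, ∃ i, s.testBit i = true ∧ c = f i
  | 0, _, _, _, _, _, _ => ⟨[], rfl, trivial, by simp⟩
  | k + 1, a, s, hp, ha, hs, hsa => by
    obtain ⟨w, hw, hp⟩ := anyMem_eq_true hp
    rw [testBit_land, Bool.and_eq_true] at hw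
    have hwn := hs w hw.2
    have hs' : ∀ i, (diff s (row T a)).testBit i = true →
        s.testBit i = true ∧ (row T a).testBit i = false := by
      intro i hi
      simpa [testBit_diff] using hi
    obtain ⟨l, hl, hpath, hmem⟩ := h.exists_path_from hn k w _ hp hwn
      (fun i hi => hs i (hs' i hi).1)
      (by simp [testBit_diff, hw.1])
    refine ⟨f w :: l, by simp [hl], ⟨(h.testBit_row hn ha hwn).mp hw.1, ?_, hpath⟩, ?_⟩
    · intro c hc
      obtain ⟨i, hi, rfl⟩ := hmem c hc
      obtain ⟨his, hia⟩ := hs' i hi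
      refine ⟨fun heq => ?_, fun hadj => ?_⟩
      · rw [h.inj a ha i (hs i his) heq, his] at hsa
        simp at hsa
      · rw [(h.testBit_row hn ha (hs i his)).mpr hadj] at hia
        simp at hia
    · intro c hc
      rcases List.mem_cons.mp hc with rfl | hc
      · exact ⟨w, hw.2, rfl⟩
      · obtain ⟨i, hi, rfl⟩ := hmem c hc
        exact ⟨i, (hs' i hi).1, rfl⟩

theorem Realizes.hasPath_eq_false (hG : IsSparse G) {n T : ℕ} {f : ℕ → V} (h : Realizes G n T f)
    (hn : n ≤ 16) : hasPath n T = false := by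
  by_contra hp
  obtain ⟨a, ha, hp⟩ := anyMem_eq_true (Bool.eq_true_of_not_eq_false hp)
  have hlt : ∀ i, (Nat.pow 2 n - 1).testBit i = true ↔ i < n := fun i => by
    change (2 ^ n - 1).testBit i = true ↔ _
    simp
  obtain ⟨l, hl, hpath, -⟩ := h.exists_path_from hn 6 a _ hp ((hlt a).mp ha)
    (fun i hi => by
      rw [testBit_diff, Bool.and_eq_true] at hi
      exact (hlt i).mp hi.1)
    (by simp [testBit_diff])
  exact hG.no_path _ hpath (by simp [hl])

/-! ### Possible neighbourhoods of a further vertex -/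

/-- Every vertex `x` outside a realization `f` of a pattern on `n` vertices has one of the masks in
`cs` as its set of neighbours. -/
def Complete (G : SimpleGraph V) (n : ℕ) (f : ℕ → V) (cs : List ℕ) : Prop :=
  ∀ x, (∀ i < n, x ≠ f i) → ∃ N ∈ cs, IsTrace G n f x N

/-- Two nonadjacent further vertices with the neighbourhoods `N` and `M` have two common
neighbours. -/
def conflictNonadj (N M : ℕ) : Bool := !atMostOne (Nat.land M N)

/-- Two adjacent further vertices with the neighbourhoods `N` and `M` create a four-cycle or a
diamond. -/
def conflictAdj (T N M : ℕ) : Bool :=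
  anyMem (fun u => !Nat.beq (Nat.land M (row T u)) 0) 16 (diff N M) ||
  anyMem (fun u => !Nat.beq (Nat.land N (row T u)) 0) 16 (diff M N) ||
  anyMem (fun u => !Nat.beq (diff (diff (Nat.land M N) (row T u)) (Nat.pow 2 u)) 0) 16
    (Nat.land M N)

/-- The possible neighbourhoods `cs` of a further vertex, updated after a vertex `n` with the
neighbourhood `N` has been added to the pattern. -/
def step (n T : ℕ) (cs : List ℕ) (N : ℕ) : List ℕ :=
  cs.filter (fun M => !conflictNonadj N M) ++
    (cs.filter (fun M => !conflictAdj T N M)).map (fun M => Nat.lor M (Nat.pow 2 n))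

theorem conflictNonadj_eq_false (hG : IsSparse G) {n T N M : ℕ} {f : ℕ → V} {x y : V}
    (h : Realizes G n T f) (hxy : x ≠ y) (hadj : ¬ G.Adj x y) (hN : IsTrace G n f x N)
    (hM : IsTrace G n f y M) : conflictNonadj N M = false := by
  by_contra hc
  obtain ⟨i, j, hij, hi, hj⟩ := atMostOne_eq_false (by simpa [conflictNonadj] using hc)
  rw [Nat.testBit_and, Bool.and_eq_true] at hi hj
  have hi' := hN.lt_of_testBit hi.2
  have hj' := hN.lt_of_testBit hj.2
  exact hij (h.inj i hi' j hj' (hG.eq_of_common x y _ _ hxy hadj ((hN.adj i hi').mp hi.2)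
    ((hM.adj i hi').mp hi.1) ((hN.adj j hj').mp hj.2) ((hM.adj j hj').mp hj.1)))

theorem conflictAdj_eq_false (hG : IsSparse G) {n T N M : ℕ} {f : ℕ → V} {x y : V}
    (h : Realizes G n T f) (hn : n ≤ 16) (hx : ∀ i < n, x ≠ f i) (hy : ∀ i < n, y ≠ f i)
    (hadj : G.Adj x y) (hN : IsTrace G n f x N) (hM : IsTrace G n f y M) :
    conflictAdj T N M = false := by
  -- The first two of the three tests are exchanged when `x` and `y` are.
  have key : ∀ {x y : V} {N M : ℕ}, (∀ i < n, x ≠ f i) → (∀ i < n, y ≠ f i) → G.Adj x y →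
      IsTrace G n f x N → IsTrace G n f y M →
      ¬ anyMem (fun u => !Nat.beq (Nat.land M (row T u)) 0) 16 (diff N M) = true := by
    intro x y N M hx hy hadj hN hM hc
    obtain ⟨u, hu, hc⟩ := anyMem_eq_true hc
    obtain ⟨w, hw⟩ := beq_zero_eq_false (by simpa using hc)
    simp only [testBit_diff, Nat.testBit_and, Bool.and_eq_true, Bool.not_eq_true'] at hu hw
    have hu' := hN.lt_of_testBit hu.1
    have hw' := hM.lt_of_testBit hw.1
    have hyu : ¬ G.Adj y (f u) := by
      rw [← hM.adj u hu', hu.2]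
      simp
    exact hx w hw' (hG.eq_of_common y (f u) x (f w) (hy u hu') hyu hadj.symm
      ((hN.adj u hu').mp hu.1).symm ((hM.adj w hw').mp hw.1) ((h.testBit_row hn hu' hw').mp hw.2))
  by_contra hc
  rw [Bool.not_eq_false, conflictAdj, Bool.or_eq_true, Bool.or_eq_true] at hc
  rcases hc with (hc | hc) | hc
  · exact key hx hy hadj hN hM hc
  · exact key hy hx hadj.symm hM hN hc
  · obtain ⟨u, hu, hc⟩ := anyMem_eq_true hc
    obtain ⟨w, hw⟩ := beq_zero_eq_false (by simpa using hc)
    simp only [testBit_diff, testBit_land, Nat.testBit_and, Nat.testBit_two_pow, Bool.and_eq_true,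
      Bool.not_eq_true', decide_eq_false_iff_not] at hu hw
    have hu' := hN.lt_of_testBit hu.2
    have hw' := hN.lt_of_testBit hw.1.1.2
    have := hG.adj_of_common x y (f u) (f w) hadj ((hN.adj u hu').mp hu.2) ((hM.adj u hu').mp hu.1)
      ((hN.adj w hw').mp hw.1.1.2) ((hM.adj w hw').mp hw.1.1.1)
      (fun heq => hw.2 (h.inj u hu' w hw' heq))
    rw [← h.testBit_row hn hu' hw', hw.1.2] at this
    simp at this

theorem Complete.step (hG : IsSparse G) {n T N : ℕ} {cs : List ℕ} {f : ℕ → V}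
    (hc : Complete G n f cs) (h : Realizes G n T f) (hn : n ≤ 16) (hx : ∀ i < n, f n ≠ f i)
    (hN : IsTrace G n f (f n) N) : Complete G (n + 1) f (step n T cs N) := by
  intro y hy
  have hy' : ∀ i < n, y ≠ f i := fun i hi => hy i (by omega)
  obtain ⟨M, hMcs, hM⟩ := hc y hy'
  have hMn : M.testBit n = false := Nat.testBit_lt_two_pow hM.lt
  have hlt : M < 2 ^ (n + 1) := hM.lt.trans (Nat.pow_lt_pow_right one_lt_two n.lt_succ_self)
  by_cases hadj : G.Adj (f n) y
  · refine ⟨Nat.lor M (Nat.pow 2 n), ?_, ?_, fun i hi => ?_⟩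
    · refine List.mem_append_right _ (List.mem_map.mpr ⟨M, List.mem_filter.mpr ⟨hMcs, ?_⟩, rfl⟩)
      rw [conflictAdj_eq_false hG h hn hx hy' hadj hN hM, Bool.not_false]
    · exact Nat.or_lt_two_pow hlt (Nat.pow_lt_pow_right one_lt_two n.lt_succ_self)
    · rw [testBit_lor, testBit_pow]
      rcases Nat.lt_succ_iff_lt_or_eq.mp hi with hi | rfl
      · simp [← hM.adj i hi, hi.ne']
      · simpa using hadj.symm
  · refine ⟨M, ?_, hlt, fun i hi => ?_⟩
    · refine List.mem_append_left _ (List.mem_filter.mpr ⟨hMcs, ?_⟩)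
      rw [conflictNonadj_eq_false hG h (hy n (by omega)).symm hadj hN hM, Bool.not_false]
    · rcases Nat.lt_succ_iff_lt_or_eq.mp hi with hi | rfl
      · exact hM.adj i hi
      · simpa [hMn] using fun h => hadj h.symm

/-- The possible neighbourhoods of a vertex outside the subpattern of `T` on the first `n`
vertices. -/
def traces (T : ℕ) : ℕ → List ℕ
  | 0 => [0]
  | n + 1 => step n T (traces T n) (Nat.land (row T n) (Nat.pow 2 n - 1))

theorem Realizes.complete_traces (hG : IsSparse G) {T : ℕ} {f : ℕ → V} :
    ∀ {n : ℕ}, Realizes G n T f → n ≤ 16 → Complete G n f (traces T n)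
  | 0, _, _ => fun _ _ => ⟨0, by simp [traces], by simp, by simp⟩
  | n + 1, h, hn => by
    have h' := h.mono n.le_succ
    have hbit : ∀ i, (Nat.land (row T n) (Nat.pow 2 n - 1)).testBit i =
        ((row T n).testBit i && decide (i < n)) := fun i => by
      rw [testBit_land]
      congr 1
      exact Nat.testBit_two_pow_sub_one n i
    refine (h'.complete_traces hG (by omega)).step hG h' (by omega)
      (fun i hi heq => hi.ne' (h.inj n (by omega) i (by omega) heq)) ⟨?_, fun i hi => ?_⟩
    · exact Nat.lt_pow_two_of_testBit _ fun i hi => by simp [hi]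
    · rw [hbit, ← h.testBit_row hn (by omega : n < n + 1) (by omega : i < n + 1)]
      simp [hi]

/-! ### The search -/

/-- The vertices `v` and `c` of the pattern `T` on `n` vertices are adjacent, and at most one
neighbour of `v` in the pattern is neither `c` nor adjacent to `c`. -/
def isDeficient (n T v c : ℕ) : Bool :=
  Nat.blt v n && Nat.blt c n && mem (row T v) c &&
    atMostOne (diff (diff (row T v) (row T c)) (Nat.pow 2 c))

/-- The masks in `cs` that contain `v` but not `c`. -/
def candidates (cs : List ℕ) (v c : ℕ) : List ℕ := cs.filter fun N => mem N v && !mem N c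

theorem Realizes.exists_candidate (hG : IsSparse G) {n T v c : ℕ} {cs : List ℕ} {f : ℕ → V}
    (h : Realizes G n T f) (hn : n ≤ 16) (hc : Complete G n f cs)
    (hd : isDeficient n T v c = true) :
    ∃ x, (∀ i < n, x ≠ f i) ∧ ∃ N ∈ candidates cs v c, IsTrace G n f x N := by
  simp only [isDeficient, Bool.and_eq_true, mem_eq_testBit] at hd
  obtain ⟨⟨⟨hv, hcn⟩, hvc⟩, hone⟩ := hd
  have hv : v < n := by simpa [Nat.blt_eq] using hv
  have hcn : c < n := by simpa [Nat.blt_eq] using hcn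
  have key : ∀ x, G.Adj (f v) x → x ≠ f c → ¬ G.Adj x (f c) → (∀ i < n, x ≠ f i) →
      ∃ x, (∀ i < n, x ≠ f i) ∧ ∃ N ∈ candidates cs v c, IsTrace G n f x N := by
    intro x hx hxc hxc' hnew
    obtain ⟨N, hNcs, hN⟩ := hc x hnew
    refine ⟨x, hnew, N, List.mem_filter.mpr ⟨hNcs, ?_⟩, hN⟩
    have hcN : ¬ N.testBit c = true := fun hb => hxc' ((hN.adj c hcn).mp hb)
    simpa [mem_eq_testBit, (hN.adj v hv).mpr hx.symm] using hcN
  obtain ⟨x, y, hxy, ⟨hx, hxc, hxc'⟩, hy, hyc, hyc'⟩ :=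
    hG.exists_two _ _ ((h.testBit_row hn hv hcn).mp hvc)
  by_contra hno
  have hx' : ¬ ∀ i < n, x ≠ f i := fun hnew => hno (key x hx hxc hxc' hnew)
  have hy' : ¬ ∀ i < n, y ≠ f i := fun hnew => hno (key y hy hyc hyc' hnew)
  push Not at hx' hy'
  obtain ⟨i, hi, rfl⟩ := hx'
  obtain ⟨j, hj, rfl⟩ := hy'
  have hbit : ∀ i < n, G.Adj (f v) (f i) → f i ≠ f c → ¬ G.Adj (f i) (f c) →
      (diff (diff (row T v) (row T c)) (Nat.pow 2 c)).testBit i = true := by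
    intro i hi hvi hic hic'
    rw [testBit_diff, testBit_diff, testBit_pow, (h.testBit_row hn hv hi).mpr hvi]
    have h1 : ¬ (row T c).testBit i = true := fun hb =>
      hic' ((h.testBit_row hn hcn hi).mp hb).symm
    have h2 : c ≠ i := by rintro rfl; exact hic rfl
    simpa [h2] using h1
  exact hxy (congrArg f (atMostOne_eq_true hone (hbit i hi hx hxc hxc') (hbit j hj hy hyc hyc')))

/-- A search script: the branchings `(v, c, L)` of the search tree in preorder. At a deficient pair
`v, c`, the candidates in `L` are pursued; all the others have to create an induced path with
seven vertices at once. -/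
abbrev Script := List (ℕ × ℕ × List ℕ)

/-- Apply `run` to all elements of a list, each time to the rest of the script that the preceding
call has left. -/
def runAll (run : Script → ℕ → Option Script) : List ℕ → Script → Option Script
  | [], s => some s
  | N :: l, s =>
    match run s N with
    | none => none
    | some s => runAll run l s

theorem runAll_eq_some {run : Script → ℕ → Option Script} : ∀ {l : List ℕ} {s s' : Script},
    runAll run l s = some s' → ∀ N ∈ l, ∃ a b, run a N = some b
  | [], _, _, _ => by simp
  | N :: l, s, s', h => by
    rw [runAll] at h
    cases hN : run s N with
    | none => simp [hN] at h
    | some t =>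
      rw [hN] at h
      intro M hM
      rcases List.mem_cons.mp hM with rfl | hM
      · exact ⟨s, t, hN⟩
      · exact runAll_eq_some h M hM

/-- The ten vertices of the pattern `T`, taken in the order `π`, induce the pattern `P`. -/
def isCopy (P T : ℕ) (π : List ℕ) : Bool :=
  (List.range 10).all fun i => Nat.blt (π.getD i 0) 10 && (List.range 10).all fun j =>
    (mem (row T (π.getD i 0)) (π.getD j 0) == mem (row P i) j) &&
      (Nat.beq i j || !Nat.beq (π.getD i 0) (π.getD j 0))

/-- Search through the extensions of the pattern `T` on `n` vertices, as prescribed by a script,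
until there is an induced path with seven vertices or a copy of the ten-vertex pattern `P`. The
list `cs` holds the possible neighbourhoods of a further vertex. The result is the unused part of
the script, or `none` if the search fails. -/
def search (P : ℕ) (πs : List (List ℕ)) : ℕ → ℕ → ℕ → List ℕ → Script → Option Script
  | 0, _, _, _, _ => none
  | k + 1, n, T, cs, s =>
    bif Nat.beq n 10 && πs.any (isCopy P T) then some s else
    match s with
    | [] => none
    | (v, c, L) :: s =>
      bif isDeficient n T v c then
        runAll (fun s N =>
          bif L.any (Nat.beq N) then search P πs k (n + 1) (extend n T N) (step n T cs N) s
          else bif hasPath (n + 1) (extend n T N) then some s else none) (candidates cs v c) s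
      else none

theorem Realizes.of_isCopy {P T : ℕ} {π : List ℕ} {f : ℕ → V} (h : Realizes G 10 T f)
    (hπ : isCopy P T π = true) : Realizes G 10 P fun i => f (π.getD i 0) := by
  have hlt : ∀ i < 10, π.getD i 0 < 10 := fun i hi => by
    have := List.all_eq_true.mp hπ i (List.mem_range.mpr hi)
    simp only [Bool.and_eq_true] at this
    simpa [Nat.blt_eq] using this.1
  have hij : ∀ i < 10, ∀ j < 10, mem (row T (π.getD i 0)) (π.getD j 0) = mem (row P i) j ∧
      (i = j ∨ π.getD i 0 ≠ π.getD j 0) := fun i hi j hj => by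
    have := List.all_eq_true.mp hπ i (List.mem_range.mpr hi)
    simp only [Bool.and_eq_true] at this
    have := List.all_eq_true.mp this.2 j (List.mem_range.mpr hj)
    simp only [Bool.and_eq_true, Bool.or_eq_true, beq_iff_eq, Bool.not_eq_true'] at this
    exact ⟨this.1, this.2.imp Nat.eq_of_beq_eq_true Nat.ne_of_beq_eq_false⟩
  refine ⟨fun i hi j hj heq => ?_, fun i hi j hj => ?_⟩
  · exact (hij i hi j hj).2.resolve_right
      fun hne => hne (h.inj _ (hlt i hi) _ (hlt j hj) heq)
  · rw [← h.testBit_row (by omega) (hlt i hi) (hlt j hj), ← Pattern.testBit_row (by omega),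
      ← mem_eq_testBit, ← mem_eq_testBit, (hij i hi j hj).1]

/-- If the search succeeds, then a sparse graph that contains the pattern `T` contains the pattern
`P`. -/
theorem Realizes.exists_of_search (hG : IsSparse G) {P : ℕ} {πs : List (List ℕ)} :
    ∀ {k n T : ℕ} {cs : List ℕ} {s s' : Script} {f : ℕ → V}, Realizes G n T f → Bounded n T →
      n + k ≤ 16 → Complete G n f cs → search P πs k n T cs s = some s' →
      ∃ π ∈ πs, ∃ g, Realizes G 10 P g
  | 0, _, _, _, _, _, _, _, _, _, _, hs => by simp [search] at hs
  | k + 1, n, T, cs, s, s', f, h, hT, hn, hc, hs => by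
    unfold search at hs
    cases hend : Nat.beq n 10 && πs.any (isCopy P T)
    · rw [hend, cond_false] at hs
      match s, hs with
      | (v, c, L) :: s, hs =>
        cases hd : isDeficient n T v c
        · simp [hd] at hs
        · simp only [hd, cond_true] at hs
          obtain ⟨x, hx, N, hNc, hN⟩ := h.exists_candidate hG (by omega) hc hd
          obtain ⟨a, b, hrun⟩ := runAll_eq_some hs N hNc
          -- `g` realizes the pattern that is extended by the vertex `x`
          let g := Function.update f n x
          have hgn : g n = x := Function.update_self ..
          have hg : ∀ i < n, g i = f i := fun i hi => Function.update_of_ne hi.ne _ _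
          have hgr : Realizes G n T g :=
            ⟨fun i hi j hj => by rw [hg i hi, hg j hj]; exact h.inj i hi j hj,
              fun i hi j hj => by rw [hg i hi, hg j hj]; exact h.adj i hi j hj⟩
          have hgx : ∀ i < n, g n ≠ g i := fun i hi => by rw [hgn, hg i hi]; exact hx i hi
          have htr : ∀ {y M}, IsTrace G n f y M → IsTrace G n g y M := fun hM =>
            ⟨hM.lt, fun i hi => by rw [hg i hi]; exact hM.adj i hi⟩
          have hgN : IsTrace G n g (g n) N := hgn ▸ htr hN
          have hgc : Complete G n g cs := fun y hy => by
            obtain ⟨M, hM, hM'⟩ := hc y fun i hi => hg i hi ▸ hy i hi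
            exact ⟨M, hM, htr hM'⟩
          have hext := hgr.extend hT (by omega) hgx hgN
          cases hL : L.any (Nat.beq N)
          · rw [hL, cond_false, hext.hasPath_eq_false hG (by omega)] at hrun
            simp at hrun
          · rw [hL, cond_true] at hrun
            exact hext.exists_of_search hG (hT.extend (by omega) hN.lt) (by omega)
              (hgc.step hG hgr (by omega) hgx hgN) hrun
    · rw [Bool.and_eq_true] at hend
      obtain rfl := Nat.eq_of_beq_eq_true hend.1
      obtain ⟨π, hmem, hπ⟩ := List.any_eq_true.mp hend.2
      exact ⟨π, hmem, _, h.of_isCopy hπ⟩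

/-! ### The Petersen graph is found and cannot be extended -/

/-- The Petersen graph as a pattern; the rows are the masks 98, 261, 522, 84, 296, 529, 137, 832,
146 and 164. -/
def petersen : ℕ := 3657371898104594493426291709394670378052550754

/-- The orders in which the ten vertices have to be read in the copies of the Petersen graph that
the search meets. -/
def petersenOrders : List (List ℕ) :=
  [[0, 1, 2, 3, 4, 5, 6, 7, 8, 9], [0, 1, 2, 3, 4, 5, 6, 7, 9, 8], [0, 1, 2, 3, 4, 8, 7, 9, 5, 6],
   [0, 1, 2, 3, 4, 9, 7, 8, 5, 6], [0, 1, 2, 3, 8, 5, 4, 9, 6, 7], [0, 1, 2, 3, 9, 5, 4, 8, 6, 7]]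

/-- The script of a search that starts from a single edge. It only guides the search, which checks
every step. -/
def petersenScript : Script :=
  [(1, 0, [2]), (2, 1, [4]), (3, 2, [8, 9]), (4, 3, [16, 17, 18, 19]), (5, 4, [33, 34, 35, 36,
   38]), (0, 1, [9, 17, 25, 73]), (5, 4, [38]), (1, 2, [18]), (2, 1, []), (2, 1, [100]), (5, 6,
   [34]), (6, 5, []), (3, 4, [72]), (4, 3, []), (0, 6, [17]), (6, 0, []), (2, 1, [4, 36]), (3,
   2, [9, 72]), (5, 4, [417]), (0, 8, []), (4, 3, [18, 19]), (7, 2, []), (8, 3, []), (3, 2,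
   [72]), (0, 1, [17]), (0, 1, []), (2, 3, [36]), (0, 1, [25]), (0, 1, []), (3, 2, [8, 25]), (6,
   2, [64, 192, 225]), (4, 5, [274, 281]), (5, 4, []), (4, 3, []), (0, 1, [161, 273]), (0, 1,
   []), (0, 1, []), (5, 6, []), (3, 4, [8]), (4, 3, [18]), (7, 3, []), (2, 1, [4]), (6, 1,
   [64]), (3, 4, [265]), (1, 2, []), (0, 1, [1, 9, 33]), (1, 0, [2, 18]), (2, 1, [36, 68]), (3,
   2, [9, 73]), (7, 1, []), (8, 2, []), (4, 3, [464]), (6, 8, []), (2, 1, [36]), (6, 0, [72]),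
   (6, 0, []), (6, 0, [64, 72]), (7, 6, [128, 146, 164]), (8, 7, [274, 292]), (2, 1, []), (1, 0,
   []), (2, 1, [4, 12, 164]), (9, 2, []), (9, 2, []), (1, 0, [2, 6, 146]), (9, 1, []), (9, 1,
   []), (6, 3, [64, 65]), (7, 3, [130, 160]), (7, 3, []), (7, 3, []), (1, 0, []), (1, 2, [18]),
   (6, 0, [76]), (6, 0, []), (2, 1, [4, 12]), (3, 4, [8, 9, 12]), (4, 3, [16, 17, 48, 80, 81,
   112]), (0, 1, [9, 81]), (0, 1, [81]), (7, 3, []), (7, 3, []), (0, 1, [9, 137]), (6, 2, []),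
   (5, 1, []), (8, 4, [260, 324]), (4, 5, []), (8, 4, []), (6, 2, [96, 224]), (8, 4, []), (0, 1,
   []), (7, 3, [129]), (5, 1, []), (4, 5, [17]), (5, 4, []), (6, 2, [64, 81, 224]), (8, 6, [273,
   416]), (5, 1, []), (0, 1, []), (5, 1, [32, 48, 224]), (9, 5, []), (9, 4, []), (0, 1, [1, 81,
   129]), (9, 0, []), (9, 0, []), (7, 2, [129, 160]), (3, 2, [9]), (7, 2, []), (3, 2, [9]), (7,
   2, []), (2, 3, [4, 6]), (6, 2, [65, 96]), (3, 2, [9]), (6, 2, []), (3, 2, [9]), (6, 2, []),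
   (7, 1, []), (1, 0, [2, 6]), (5, 0, [32, 48]), (0, 1, [1, 9]), (2, 3, [388]), (0, 1, []), (8,
   3, []), (0, 1, []), (0, 1, [9]), (0, 1, []), (0, 1, [1, 17]), (1, 0, [2, 6]), (2, 3, [4, 6,
   36]), (3, 2, [8, 24, 40, 72, 88, 104]), (5, 0, [36, 104]), (5, 0, [104]), (7, 2, []), (7, 2,
   []), (8, 3, [258, 322]), (3, 4, []), (8, 3, []), (4, 0, [16, 88]), (5, 0, [548]), (6, 1, []),
   (4, 3, []), (6, 1, [80, 208]), (8, 3, []), (5, 0, []), (3, 4, [40]), (4, 3, []), (7, 2,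
   [160]), (4, 0, []), (7, 1, [144, 160]), (2, 1, [36]), (7, 1, []), (2, 1, [36]), (7, 1, []),
   (6, 1, [64, 104, 208]), (8, 6, [296, 400]), (4, 0, []), (3, 2, []), (4, 0, [16, 24, 208]),
   (9, 4, []), (9, 3, []), (3, 2, [8, 24, 104]), (9, 3, []), (9, 3, []), (1, 2, [2, 3]), (6, 1,
   [80, 96]), (2, 1, [36]), (6, 1, []), (2, 1, [36]), (6, 1, []), (7, 0, []), (0, 4, [1, 3]),
   (4, 0, [16, 24]), (5, 0, [32, 36]), (1, 2, [386]), (5, 0, []), (8, 2, []), (5, 0, []), (5, 0,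
   [36]), (4, 0, [])]

/-- The digits 1 and 16 of `65538` form the pattern of a single edge. -/
theorem search_edge : (search petersen petersenOrders 14 2 65538 (traces 65538 2)
    petersenScript).isSome = true := by
  decide +kernel

/-- A further vertex with some neighbour in a Petersen graph cannot get its two private neighbours
without creating an induced path with seven vertices. -/
theorem search_petersen : ((traces petersen 10).all fun N => Nat.beq N 0 ||
    (search petersen [] 1 11 (extend 10 petersen N) (step 10 petersen (traces petersen 10) N)
      [(10, Nat.log2 N, [])]).isSome) = true := by
  decide +kernel

theorem bounded_petersen : Bounded 10 petersen := by
  have key : ∀ p < 160, petersen.testBit p = true → p / 16 < 10 ∧ p % 16 < 10 := by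
    decide +kernel
  intro p hp
  refine key p ?_ hp
  by_contra hlt
  have := Nat.testBit_lt_two_pow (lt_of_lt_of_le (by decide +kernel : petersen < 2 ^ 160)
    (Nat.pow_le_pow_right two_pos (not_lt.mp hlt)))
  simp [this] at hp

/-- A sparse graph with an edge contains the Petersen graph as an induced subgraph. -/
theorem exists_realizes_petersen (hG : IsSparse G) {a b : V} (hab : G.Adj a b) :
    ∃ f, Realizes G 10 petersen f := by
  have h : Realizes G 2 65538 fun i => if i = 0 then a else b := by
    constructor
    · intro i hi j hj
      interval_cases i <;> interval_cases j <;> simp [hab.ne, hab.ne']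
    · intro i hi j hj
      interval_cases i <;> interval_cases j <;> simp [hab, hab.symm] <;> decide
  have hT : Bounded 2 65538 := by
    have key : ∀ p < 32, (65538 : ℕ).testBit p = true → p / 16 < 2 ∧ p % 16 < 2 := by
      decide +kernel
    intro p hp
    refine key p ?_ hp
    by_contra hlt
    have := Nat.testBit_lt_two_pow (lt_of_lt_of_le (by decide +kernel : 65538 < 2 ^ 32)
      (Nat.pow_le_pow_right two_pos (not_lt.mp hlt)))
    simp [this] at hp
  obtain ⟨s, hs⟩ := Option.isSome_iff_exists.mp search_edge
  obtain ⟨-, -, g⟩ := h.exists_of_search hG hT (by norm_num) (h.complete_traces hG (by norm_num)) hs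
  exact g

/-- In a sparse graph, no vertex outside an induced Petersen graph has a neighbour in it. -/
theorem Realizes.not_adj_petersen (hG : IsSparse G) {f : ℕ → V} (h : Realizes G 10 petersen f)
    {x : V} (hx : ∀ i < 10, x ≠ f i) : ∀ i < 10, ¬ G.Adj x (f i) := by
  intro i hi hadj
  let g := Function.update f 10 x
  have hgx : g 10 = x := Function.update_self ..
  have hg : ∀ i < 10, g i = f i := fun i hi => Function.update_of_ne hi.ne _ _
  have hgr : Realizes G 10 petersen g :=
    ⟨fun i hi j hj => by rw [hg i hi, hg j hj]; exact h.inj i hi j hj,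
      fun i hi j hj => by rw [hg i hi, hg j hj]; exact h.adj i hi j hj⟩
  have hgne : ∀ i < 10, g 10 ≠ g i := fun i hi => by rw [hgx, hg i hi]; exact hx i hi
  have hc := hgr.complete_traces hG (by norm_num)
  obtain ⟨N, hNc, hN⟩ := hc (g 10) hgne
  have hN0 : Nat.beq N 0 = false := by
    rw [Bool.eq_false_iff]
    intro h0
    have := (hN.adj i hi).mpr (by rw [hgx, hg i hi]; exact hadj)
    rw [Nat.eq_of_beq_eq_true h0] at this
    simp at this
  have hs := List.all_eq_true.mp search_petersen N hNc
  rw [hN0, Bool.false_or] at hs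
  obtain ⟨s, hs⟩ := Option.isSome_iff_exists.mp hs
  have hext := hgr.extend bounded_petersen (by norm_num) hgne hN
  obtain ⟨π, hπ, -⟩ := hext.exists_of_search hG (bounded_petersen.extend (by norm_num) hN.lt)
    (by norm_num) (hc.step hG hgr (by norm_num) hgne hN) hs
  simp at hπ

end Pattern

/-! ### Diamonds in graphs without clique cutsets -/

/-- The graph has no induced four-cycle, no induced kite and no clique cutset. The three conditions
are stated in elementary form; the last one says that an edge leaves each set `A` of vertices that
does not exhaust the complement of a clique `K`. -/
structure IsKiteFreeAtom {V : Type*} (G : SimpleGraph V) : Prop where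
  square : ∀ a b c d, G.Adj a b → G.Adj b c → G.Adj c d → G.Adj d a → a ≠ c → b ≠ d →
    G.Adj a c ∨ G.Adj b d
  kite : ∀ a b c d e, G.Adj a b → G.Adj a c → G.Adj b c → G.Adj b d → G.Adj c d → G.Adj d e →
    a ≠ d → ¬ G.Adj a d → ¬ G.Adj a e → G.Adj b e ∨ G.Adj c e
  exists_edge : ∀ K A : Set V, G.IsClique K → A.Nonempty → (∀ v ∈ A, v ∉ K) →
    (∃ q, q ∉ A ∧ q ∉ K) → ∃ a ∈ A, ∃ b, b ∉ A ∧ b ∉ K ∧ G.Adj a b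

namespace IsKiteFreeAtom

variable {V : Type*} {G : SimpleGraph V}

/-- In a diamond, every neighbour of a vertex of degree two is adjacent to one of the two vertices
of degree three. -/
theorem adj_or_adj (hG : IsKiteFreeAtom G) {a b c d e : V} (hab : G.Adj a b) (hac : G.Adj a c)
    (hbc : G.Adj b c) (hbd : G.Adj b d) (hcd : G.Adj c d) (hde : G.Adj d e) (hne : a ≠ d)
    (had : ¬ G.Adj a d) : G.Adj b e ∨ G.Adj c e := by
  by_cases hae : G.Adj a e
  · by_cases hbe : b = e
    · exact Or.inr (hbe ▸ hbc.symm)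
    · exact Or.inl ((hG.square a b d e hab hbd hde hae.symm hne hbe).resolve_left had)
  · exact hG.kite a b c d e hab hac hbc hbd hcd hde hne had hae

/-- A vertex `b` whose closed neighbourhood contains that of another vertex `c` is universal. The
vertices whose closed neighbourhood lies in that of `b` would otherwise have a component around `c`
whose boundary is a clique. -/
theorem universal_of_dominates (hG : IsKiteFreeAtom G) {b c : V} (hbc : G.Adj b c)
    (hdom : ∀ v, G.Adj c v → v = b ∨ G.Adj b v) (z : V) (hz : z ≠ b) : G.Adj b z := by
  by_contra hbz
  let D : Set V := {v | G.Adj b v ∧ ∀ w, G.Adj v w → w = b ∨ G.Adj b w}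
  let Q : Set V := {v | Relation.ReflTransGen (fun x y => G.Adj x y ∧ y ∈ D) c v}
  have hcQ : c ∈ Q := Relation.ReflTransGen.refl
  have hQD : ∀ q ∈ Q, q ∈ D := by
    intro q hq
    rcases Relation.ReflTransGen.cases_tail hq with rfl | ⟨p, -, -, h⟩
    · exact ⟨hbc, hdom⟩
    · exact h
  -- A vertex of the boundary of `Q` other than `b` has a neighbour not dominated by `b`.
  have hout : ∀ u, u ∉ Q → u ≠ b → ∀ q ∈ Q, G.Adj q u →
      G.Adj b u ∧ ∃ w, G.Adj u w ∧ w ≠ b ∧ ¬ G.Adj b w := by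
    intro u hu hub q hq hqu
    have hbu : G.Adj b u := ((hQD q hq).2 u hqu).resolve_left hub
    refine ⟨hbu, ?_⟩
    by_contra hno
    push Not at hno
    refine hu (Relation.ReflTransGen.tail hq ⟨hqu, hbu, fun w hw => ?_⟩)
    by_cases hwb : w = b
    · exact Or.inl hwb
    · exact Or.inr (hno w hw hwb)
  -- Such a vertex is adjacent to all of `Q`.
  have hcomplete : ∀ u, u ∉ Q → u ≠ b → ∀ q ∈ Q, G.Adj q u → G.Adj c u := by
    intro u hu hub q hq hqu
    obtain ⟨hbu, w, huw, hwb, hbw⟩ := hout u hu hub q hq hqu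
    have hmove : ∀ p ∈ Q, ∀ p' ∈ Q, G.Adj p p' → G.Adj p u → G.Adj p' u := by
      intro p hp p' hp' hpp' hpu
      by_contra hp'u
      rcases hG.adj_or_adj (hQD p' hp').1.symm hpp'.symm (hQD p hp).1 hbu hpu huw
        (fun h => hu (h ▸ hp')) hp'u with h | h
      · exact hbw h
      · rcases (hQD p hp).2 w h with h | h
        · exact hwb h
        · exact hbw h
    have hback : ∀ p, Relation.ReflTransGen (fun x y => G.Adj x y ∧ y ∈ D) c p →
        G.Adj p u → G.Adj c u := by
      intro p hp
      induction hp with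
      | refl => exact id
      | tail hp hstep ih =>
        exact fun h => ih (hmove _ (hp.tail hstep) _ hp hstep.1.symm h)
    exact hback q hq hqu
  let K : Set V := {u | u = b ∨ (u ∉ Q ∧ ∃ q ∈ Q, G.Adj q u)}
  have hbQ : b ∉ Q := fun h => (hQD b h).1.ne rfl
  have hK : G.IsClique K := by
    rintro u (rfl | ⟨hu, q, hq, hqu⟩) v (rfl | ⟨hv, r, hr, hrv⟩) huv
    · exact absurd rfl huv
    · exact (hout v hv huv.symm r hr hrv).1
    · exact (hout u hu huv q hq hqu).1.symm
    · by_cases hub : u = b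
      · subst hub
        exact (hout v hv huv.symm r hr hrv).1
      by_cases hvb : v = b
      · subst hvb
        exact (hout u hu huv q hq hqu).1.symm
      by_contra hadj
      obtain ⟨hbu, -⟩ := hout u hu hub q hq hqu
      obtain ⟨hbv, w, hvw, hwb, hbw⟩ := hout v hv hvb r hr hrv
      rcases hG.adj_or_adj hbu.symm (hcomplete u hu hub q hq hqu).symm hbc hbv
        (hcomplete v hv hvb r hr hrv) hvw huv hadj with h | h
      · exact hbw h
      · rcases hdom w h with h | h
        · exact hwb h
        · exact hbw h
  obtain ⟨q, hq, u, hu, huK, hqu⟩ := hG.exists_edge K Q hK ⟨c, hcQ⟩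
    (fun v hv => by
      rintro (rfl | ⟨h, -⟩)
      · exact hbQ hv
      · exact h hv)
    ⟨z, fun h => hbz (hQD z h).1, by
      rintro (h | ⟨-, q, hq, hqz⟩)
      · exact hz h
      · exact ((hQD q hq).2 z hqz).elim hz hbz⟩
  exact huK (Or.inr ⟨hu, q, hq, hqu⟩)

/-- Let `a` and `d` be nonadjacent common neighbours of the edge `b c`, and let `x` and `y` be
private neighbours of `b` and of `c`. Then `d` is not adjacent to `x`: otherwise `b c d` is the
inner triangle of a three-sun, and `b`, `c` and the common neighbours of `b c d` next to the
vertices around `a` form a clique cutset. -/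
theorem not_adj_of_diamond (hG : IsKiteFreeAtom G) {a b c d x y : V} (hab : G.Adj a b)
    (hac : G.Adj a c) (hbc : G.Adj b c) (hbd : G.Adj b d) (hcd : G.Adj c d) (hne : a ≠ d)
    (had : ¬ G.Adj a d) (hbx : G.Adj b x) (hxc : x ≠ c) (hcx : ¬ G.Adj c x) (hcy : G.Adj c y)
    (hyb : y ≠ b) (hby : ¬ G.Adj b y) : ¬ G.Adj d x := by
  intro hdx
  have hdy : G.Adj d y := (hG.adj_or_adj hbx.symm hdx.symm hbd hbc hcd.symm hcy hxc
    (fun h => hcx h.symm)).resolve_left hby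
  let X : Set V := {v | G.Adj b v ∧ G.Adj c v ∧ v ≠ d ∧ ¬ G.Adj d v}
  let W : Set V := {w | G.Adj b w ∧ G.Adj c w ∧ G.Adj d w ∧ ∃ v ∈ X, G.Adj v w}
  -- The neighbours of the vertices of `X` are `b`, `c`, and vertices of `X` and `W`.
  have hX : ∀ v ∈ X, ∀ w, G.Adj v w → w ≠ b → w ≠ c → w ∉ X → w ∈ W := by
    rintro v ⟨hbv, hcv, hvd, hdv⟩ w hvw hwb hwc hwX
    have hboth : G.Adj b w ∧ G.Adj c w := by
      rcases hG.adj_or_adj hbd.symm hcd.symm hbc hbv hcv hvw hvd.symm hdv with h | h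
      · refine ⟨h, ?_⟩
        rcases hG.adj_or_adj hcy.symm hdy.symm hcd hbc.symm hbd.symm h hyb (fun h => hby h.symm)
          with h | h
        · exact h
        · exact ((hG.square d w v c h hvw.symm hcv.symm hcd hvd.symm hwc).resolve_left hdv).symm
      · refine ⟨?_, h⟩
        rcases hG.adj_or_adj hbx.symm hdx.symm hbd hbc hcd.symm h hxc (fun h => hcx h.symm)
          with h | h
        · exact h
        · exact ((hG.square d w v b h hvw.symm hbv.symm hbd hvd.symm hwb).resolve_left hdv).symm
    refine ⟨hboth.1, hboth.2, ?_, v, ⟨hbv, hcv, hvd, hdv⟩, hvw⟩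
    by_contra hdw
    exact hwX ⟨hboth.1, hboth.2, fun h => hdv (h ▸ hvw).symm, hdw⟩
  have hWx : ∀ w ∈ W, G.Adj w x := by
    rintro w ⟨hbw, hcw, hdw, v, ⟨hbv, hcv, hvd, hdv⟩, hvw⟩
    exact (hG.adj_or_adj hcv.symm hvw hcw hcd hdw.symm hdx hvd (fun h => hdv h.symm)).resolve_left
      hcx
  have hK : G.IsClique ({v | v = b ∨ v = c} ∪ W) := by
    rintro u ((rfl | rfl) | hu) v ((rfl | rfl) | hv) huv
    · exact absurd rfl huv
    · exact hbc
    · exact hv.1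
    · exact hbc.symm
    · exact absurd rfl huv
    · exact hv.2.1
    · exact hu.1.symm
    · exact hu.2.1.symm
    · exact (hG.square u x v c (hWx u hu) (hWx v hv).symm hv.2.1.symm hu.2.1 huv hxc).resolve_right
        fun h => hcx h.symm
  obtain ⟨v, hv, w, hwX, hwK, hvw⟩ := hG.exists_edge _ X hK
    ⟨a, hab.symm, hac.symm, hne, fun h => had h.symm⟩
    (by
      rintro v hv ((rfl | rfl) | h)
      · exact hv.1.ne rfl
      · exact hv.2.1.ne rfl
      · exact hv.2.2.2 h.2.2.1)
    ⟨d, fun h => h.2.2.1 rfl, by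
      rintro ((h | h) | h)
      · exact hbd.ne h.symm
      · exact hcd.ne h.symm
      · exact h.2.2.1.ne rfl⟩
  exact hwK (Or.inr (hX v hv w hvw (fun h => hwK (Or.inl (Or.inl h)))
    (fun h => hwK (Or.inl (Or.inr h))) hwX))

/-- Without a universal vertex there is no diamond. The vertices of degree two in the diamonds with
central edge `b c` would be separated by a clique from the private neighbours of `b`. -/
theorem adj_of_common (hG : IsKiteFreeAtom G) (hU : ∀ u, ∃ v, v ≠ u ∧ ¬ G.Adj u v) {b c a d : V}
    (hbc : G.Adj b c) (hba : G.Adj b a) (hca : G.Adj c a) (hbd : G.Adj b d) (hcd : G.Adj c d)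
    (hne : a ≠ d) : G.Adj a d := by
  by_contra had
  have hprivate : ∀ {b c : V}, G.Adj b c → ∃ y, G.Adj c y ∧ y ≠ b ∧ ¬ G.Adj b y := by
    intro b c hbc
    by_contra hno
    push Not at hno
    obtain ⟨z, hz, hbz⟩ := hU b
    refine hbz (hG.universal_of_dominates hbc (fun v hv => ?_) z hz)
    by_cases hvb : v = b
    · exact Or.inl hvb
    · exact Or.inr (hno v hv hvb)
  obtain ⟨y, hcy, hyb, hby⟩ := hprivate hbc
  obtain ⟨x, hbx, hxc, hcx⟩ := hprivate hbc.symm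
  let A : Set V := {v | G.Adj b v ∧ G.Adj c v}
  let D : Set V := {v | v ∈ A ∧ ∃ u ∈ A, u ≠ v ∧ ¬ G.Adj u v}
  have hD : ∀ v ∈ D, ∀ w, G.Adj v w → w ≠ b → w ≠ c → w ∈ A := by
    rintro v ⟨⟨hbv, hcv⟩, u, ⟨hbu, hcu⟩, huv, hadj⟩ w hvw hwb hwc
    by_contra hwA
    rcases hG.adj_or_adj hbu.symm hcu.symm hbc hbv hcv hvw huv hadj with h | h
    · exact hG.not_adj_of_diamond hbu.symm hcu.symm hbc hbv hcv huv hadj h hwc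
        (fun h' => hwA ⟨h, h'⟩) hcy hyb hby hvw
    · exact hG.not_adj_of_diamond hcu.symm hbu.symm hbc.symm hcv hbv huv hadj h hwb
        (fun h' => hwA ⟨h', h⟩) hbx hxc hcx hvw
  have hK : G.IsClique ({v | v = b ∨ v = c} ∪ (A \ D)) := by
    rintro u ((rfl | rfl) | hu) v ((rfl | rfl) | hv) huv
    · exact absurd rfl huv
    · exact hbc
    · exact hv.1.1
    · exact hbc.symm
    · exact absurd rfl huv
    · exact hv.1.2
    · exact hu.1.1.symm
    · exact hu.1.2.symm
    · by_contra hadj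
      exact hv.2 ⟨hv.1, u, hu.1, huv, hadj⟩
  obtain ⟨v, hv, w, hwD, hwK, hvw⟩ := hG.exists_edge _ D hK
    ⟨d, ⟨hbd, hcd⟩, a, ⟨hba, hca⟩, hne, had⟩
    (by
      rintro v hv ((rfl | rfl) | h)
      · exact hv.1.1.ne rfl
      · exact hv.1.2.ne rfl
      · exact h.2 hv)
    ⟨x, fun h => hcx h.1.2, by
      rintro ((h | h) | h)
      · exact hbx.ne h.symm
      · exact hxc h
      · exact hcx h.1.2⟩
  exact hwK (Or.inr ⟨hD v hv w hvw (fun h => hwK (Or.inl (Or.inl h)))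
    (fun h => hwK (Or.inl (Or.inr h))), hwD⟩)

end IsKiteFreeAtom

/-! ### From the hypotheses to the elementary conditions -/

theorem IsKiteFreeAtom.of_free {V : Type*} [Finite V] {G : SimpleGraph V} (hconn : G.Connected)
    (hC4 : InducedFree G (SimpleGraph.cycleGraph 4)) (hkite : InducedFree G _root_.kite)
    (hcut : ¬ ∃ K : Set V, IsCliqueCutset G K) : IsKiteFreeAtom G where
  square a b c d hab hbc hcd hda hac hbd := by
    by_contra! hno
    have hinj : Function.Injective ![a, b, c, d] := by
      intro i j hij
      fin_cases i <;> fin_cases j <;>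
        simp_all [hab.ne, hbc.ne, hcd.ne, hda.ne, hab.ne', hbc.ne', hcd.ne', hda.ne', hac.symm,
          hbd.symm]
    refine hC4 ⟨⟨⟨_, hinj⟩, fun {i j} => ?_⟩⟩
    change G.Adj (![a, b, c, d] i) (![a, b, c, d] j) ↔ _
    have hc : ∀ i j : Fin 4, (SimpleGraph.cycleGraph 4).Adj i j ↔ (j = i + 1 ∨ i = j + 1) := by
      decide
    rw [hc]
    have h1 := hno.1
    have h2 := hno.2
    have h3 : ¬ G.Adj c a := fun h => h1 h.symm
    have h4 : ¬ G.Adj d b := fun h => h2 h.symm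
    fin_cases i <;> fin_cases j <;>
      simp [hab, hbc, hcd, hda, hab.symm, hbc.symm, hcd.symm, hda.symm, h1, h2, h3, h4]
  kite a b c d e hab hac hbc hbd hcd hde hne had hae := by
    by_contra! hno
    have h1 := hno.1
    have h2 := hno.2
    have h3 : ¬ G.Adj e b := fun h => h1 h.symm
    have h4 : ¬ G.Adj e c := fun h => h2 h.symm
    have h5 : ¬ G.Adj d a := fun h => had h.symm
    have h6 : ¬ G.Adj e a := fun h => hae h.symm
    have hea : a ≠ e := by rintro rfl; exact h5 hde
    have heb : b ≠ e := by rintro rfl; exact hae hab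
    have hec : c ≠ e := by rintro rfl; exact hae hac
    have hinj : Function.Injective ![a, b, c, d, e] := by
      intro i j hij
      fin_cases i <;> fin_cases j <;>
        simp_all [hab.ne, hac.ne, hbc.ne, hbd.ne, hcd.ne, hde.ne, hab.ne', hac.ne', hbc.ne',
          hbd.ne', hcd.ne', hde.ne', hne.symm, hea.symm, heb.symm, hec.symm]
    refine hkite ⟨⟨⟨_, hinj⟩, fun {i j} => ?_⟩⟩
    change G.Adj (![a, b, c, d, e] i) (![a, b, c, d, e] j) ↔ _
    rw [_root_.kite, SimpleGraph.fromEdgeSet_adj]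
    fin_cases i <;> fin_cases j <;>
      simp [hab, hac, hbc, hbd, hcd, hde, hab.symm, hac.symm, hbc.symm, hbd.symm, hcd.symm,
        hde.symm, had, hae, h1, h2, h3, h4, h5, h6]
  exists_edge K A hK hA hAK hq := by
    obtain ⟨p, hp⟩ := hA
    obtain ⟨q, hqA, hqK⟩ := hq
    by_contra! hno
    refine hcut ⟨K, hK, ?_⟩
    have hsub := hconn.preconnected.subsingleton_connectedComponent
    refine lt_of_le_of_lt (Finite.card_le_one_iff_subsingleton.mpr hsub)
      (Finite.one_lt_card_iff_nontrivial.mpr ?_)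
    refine ⟨(G.induce Kᶜ).connectedComponentMk ⟨p, hAK p hp⟩,
      (G.induce Kᶜ).connectedComponentMk ⟨q, hqK⟩, fun heq => ?_⟩
    obtain ⟨walk⟩ := SimpleGraph.ConnectedComponent.exact heq
    obtain ⟨e, -, he1, he2⟩ := walk.exists_boundary_dart {v | v.1 ∈ A} hp hqA
    exact hno e.fst.1 he1 e.snd.1 he2 e.snd.2 e.adj

/-! ### Removing the universal vertices -/

section Universal

variable {V : Type*} (G : SimpleGraph V)

/-- The vertices that are adjacent to all other vertices. -/
def universalVerts : Set V := {u | ∀ v, v ≠ u → G.Adj u v}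

/-- The graph without its universal vertices. -/
abbrev coreGraph : SimpleGraph ((universalVerts G)ᶜ : Set V) := G.induce (universalVerts G)ᶜ

variable {G}

theorem core_not_universal (u : ((universalVerts G)ᶜ : Set V)) :
    ∃ v, v ≠ u ∧ ¬ (coreGraph G).Adj u v := by
  obtain ⟨u, hu⟩ := u
  have hu' : ¬ ∀ v, v ≠ u → G.Adj u v := hu
  push Not at hu'
  obtain ⟨v, hvu, hadj⟩ := hu'
  exact ⟨⟨v, fun hv => hadj (hv u hvu.symm).symm⟩, fun h => hvu (congrArg Subtype.val h), hadj⟩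

theorem IsKiteFreeAtom.core (hG : IsKiteFreeAtom G) : IsKiteFreeAtom (coreGraph G) where
  square a b c d hab hbc hcd hda hac hbd :=
    hG.square a b c d hab hbc hcd hda (Subtype.coe_ne_coe.mpr hac) (Subtype.coe_ne_coe.mpr hbd)
  kite a b c d e hab hac hbc hbd hcd hde hne had hae :=
    hG.kite a b c d e hab hac hbc hbd hcd hde (Subtype.coe_ne_coe.mpr hne) had hae
  exists_edge K A hK hA hAK hq := by
    obtain ⟨q, hqA, hqK⟩ := hq
    have hK' : G.IsClique (universalVerts G ∪ Subtype.val '' K) := by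
      rintro u (hu | ⟨u, hu, rfl⟩) v (hv | ⟨v, hv, rfl⟩) huv
      · exact hu v huv.symm
      · exact hu v huv.symm
      · exact (hv u huv).symm
      · exact hK hu hv (fun h => huv (congrArg Subtype.val h))
    have hnot : ∀ {v : ((universalVerts G)ᶜ : Set V)}, v ∉ K →
        v.1 ∉ universalVerts G ∪ Subtype.val '' K := by
      rintro v hv (h | ⟨w, hw, heq⟩)
      · exact v.2 h
      · exact hv (Subtype.ext heq ▸ hw)
    obtain ⟨-, ⟨a, ha, rfl⟩, b, hbA, hbK, hab⟩ := hG.exists_edge _ (Subtype.val '' A) hK'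
      (hA.image _) (by rintro - ⟨v, hv, rfl⟩; exact hnot (hAK v hv))
      ⟨q.1, by rintro ⟨v, hv, heq⟩; exact hqA (Subtype.ext heq ▸ hv), hnot hqK⟩
    have hbU : b ∈ (universalVerts G)ᶜ := fun h => hbK (Or.inl h)
    exact ⟨a, ha, ⟨b, hbU⟩, fun h => hbA ⟨_, h, rfl⟩, fun h => hbK (Or.inr ⟨_, h, rfl⟩), hab⟩

open Classical in
/-- If the degree of `v` exceeds the clique number, then `v` has two neighbours outside each clique
that contains it. -/
theorem exists_two_notMem_clique [Fintype V] [DecidableRel G.Adj]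
    (hdeg : G.cliqueNum + 1 ≤ G.minDegree) {K : Set V} (hK : G.IsClique K) {v : V} (hv : v ∈ K) :
    ∃ x y, x ≠ y ∧ (G.Adj v x ∧ x ∉ K) ∧ (G.Adj v y ∧ y ∉ K) := by
  have hKf : G.IsClique (K.toFinset : Set V) := by simpa using hK
  have h1 := hKf.card_le_cliqueNum
  have h2 := G.minDegree_le_degree v
  have hvK : v ∈ K.toFinset := by simpa using hv
  have h3 : G.neighborFinset v ⊆ (G.neighborFinset v \ K.toFinset) ∪ K.toFinset.erase v := by
    intro w hw
    by_cases hwK : w ∈ K.toFinset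
    · refine Finset.mem_union_right _ (Finset.mem_erase.mpr ⟨?_, hwK⟩)
      exact ((G.mem_neighborFinset v w).mp hw).ne'
    · exact Finset.mem_union_left _ (Finset.mem_sdiff.mpr ⟨hw, hwK⟩)
  have h4 := (Finset.card_le_card h3).trans (Finset.card_union_le _ _)
  rw [Finset.card_erase_of_mem hvK, G.card_neighborFinset_eq_degree] at h4
  have h5 := Finset.card_pos.mpr ⟨v, hvK⟩
  obtain ⟨x, hx, y, hy, hxy⟩ := Finset.one_lt_card.mp
    (show 1 < (G.neighborFinset v \ K.toFinset).card by omega)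
  simp only [Finset.mem_sdiff, SimpleGraph.mem_neighborFinset, Set.mem_toFinset] at hx hy
  exact ⟨x, y, hxy, hx, hy⟩

theorem IsKiteFreeAtom.isSparse_core [Fintype V] [DecidableRel G.Adj] (hG : IsKiteFreeAtom G)
    (hP7 : InducedFree G (SimpleGraph.pathGraph 7)) (hdeg : G.cliqueNum + 1 ≤ G.minDegree) :
    IsSparse (coreGraph G) where
  eq_of_common x y u w hxy hadj hxu hyu hxw hyw := by
    by_contra huw
    have huw' := (hG.core.square x u y w hxu hyu.symm hyw hxw.symm hxy huw).resolve_left hadj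
    exact hadj (hG.core.adj_of_common core_not_universal huw' hxu.symm hxw.symm hyu.symm hyw.symm
      hxy)
  adj_of_common x y u w hxy hxu hyu hxw hyw huw :=
    hG.core.adj_of_common core_not_universal hxy hxu hyu hxw hyw huw
  exists_two v c hvc := by
    have hvc' : G.Adj v.1 c.1 := hvc
    have hK : G.IsClique {u | u = v.1 ∨ u = c.1 ∨ (G.Adj v u ∧ G.Adj c u)} := by
      rintro u (rfl | rfl | hu) w (rfl | rfl | hw) huw
      · exact absurd rfl huw
      · exact hvc'
      · exact hw.1
      · exact hvc'.symm
      · exact absurd rfl huw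
      · exact hw.2
      · exact hu.1.symm
      · exact hu.2.symm
      · by_cases hu' : u ∈ universalVerts G
        · exact hu' w huw.symm
        by_cases hw' : w ∈ universalVerts G
        · exact (hw' u huw).symm
        exact hG.core.adj_of_common (a := ⟨u, hu'⟩) (d := ⟨w, hw'⟩) core_not_universal hvc hu.1 hu.2
          hw.1 hw.2 (fun h => huw (congrArg Subtype.val h))
    -- A neighbour of `v` outside this clique is not a universal vertex.
    have hmem : ∀ x, G.Adj v x → x ∉ {u | u = v.1 ∨ u = c.1 ∨ (G.Adj v u ∧ G.Adj c u)} →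
        x ∈ (universalVerts G)ᶜ ∧ x ≠ c.1 ∧ ¬ G.Adj x c := by
      intro x hvx hx
      have hxc : x ≠ c.1 := fun h => hx (Or.inr (Or.inl h))
      have hadj : ¬ G.Adj x c := fun h => hx (Or.inr (Or.inr ⟨hvx, h.symm⟩))
      exact ⟨fun h => hadj (h c hxc.symm), hxc, hadj⟩
    obtain ⟨x, y, hxy, ⟨hvx, hx⟩, hvy, hy⟩ := exists_two_notMem_clique hdeg hK (Or.inl rfl)
    obtain ⟨hxU, hxc, hxc'⟩ := hmem x hvx hx
    obtain ⟨hyU, hyc, hyc'⟩ := hmem y hvy hy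
    exact ⟨⟨x, hxU⟩, ⟨y, hyU⟩, fun h => hxy (congrArg Subtype.val h),
      ⟨hvx, fun h => hxc (congrArg Subtype.val h), hxc'⟩,
      hvy, fun h => hyc (congrArg Subtype.val h), hyc'⟩
  no_path l hl h7 := by
    have h := hl.isIndContained
    rw [h7] at h
    exact hP7 (h.trans ⟨SimpleGraph.Embedding.induce _⟩)

theorem exists_core_adj [Fintype V] [Nonempty V] [DecidableRel G.Adj]
    (hdeg : G.cliqueNum + 1 ≤ G.minDegree) : ∃ a b, (coreGraph G).Adj a b := by
  have hU : G.IsClique (universalVerts G) := fun u hu v _ huv => hu v huv.symm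
  -- There is a vertex that is not universal, since a vertex has a neighbour outside each clique.
  obtain ⟨p, hp⟩ : ∃ p, p ∉ universalVerts G := by
    by_contra! hall
    obtain ⟨x, -, -, ⟨-, hx⟩, -⟩ :=
      exists_two_notMem_clique hdeg hU (hall (Classical.arbitrary V))
    exact hx (hall x)
  have hK : G.IsClique (insert p (universalVerts G)) :=
    hU.insert fun u hu _ => (hu p (fun h => hp (h ▸ hu))).symm
  obtain ⟨x, -, -, ⟨hpx, hx⟩, -⟩ := exists_two_notMem_clique hdeg hK (Set.mem_insert _ _)
  exact ⟨⟨p, hp⟩, ⟨x, fun h => hx (Set.mem_insert_of_mem _ h)⟩, hpx⟩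

/-- A graph is the complete join of the clique of its universal vertices and the rest. -/
theorem exists_iso_graphJoin [Finite V] {W : Type*} {H : SimpleGraph W} (e : coreGraph G ≃g H) :
    ∃ ℓ : ℕ, Nonempty (G ≃g graphJoin (⊤ : SimpleGraph (Fin ℓ)) H) := by
  classical
  obtain ⟨ℓ, ⟨eU⟩⟩ := Finite.exists_equiv_fin (universalVerts G)
  let φ := (Equiv.sumCongr eU.symm e.symm.toEquiv).trans (Equiv.Set.sumCompl (universalVerts G))
  refine ⟨ℓ, ⟨SimpleGraph.Iso.symm ⟨φ, fun {i j} => ?_⟩⟩⟩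
  have hφl : ∀ i, φ (.inl i) = (eU.symm i).1 := fun i => rfl
  have hφr : ∀ i, φ (.inr i) = (e.symm i).1 := fun i => rfl
  have hne : ∀ i j, (e.symm j).1 ≠ (eU.symm i).1 := fun i j h =>
    (e.symm j).2 (h ▸ (eU.symm i).2)
  rcases i with i | i <;> rcases j with j | j
  · rw [hφl, hφl]
    have : G.Adj (eU.symm i) (eU.symm j) ↔ i ≠ j := by
      constructor
      · rintro h rfl
        exact h.ne rfl
      · exact fun h => (eU.symm i).2 _ fun h' => h (eU.symm.injective (Subtype.ext h')).symm
    simp [graphJoin, this]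
  · rw [hφl, hφr]
    have : G.Adj (eU.symm i) (e.symm j) := (eU.symm i).2 _ (hne i j)
    simp [graphJoin, this]
  · rw [hφl, hφr]
    have : G.Adj (e.symm i) (eU.symm j) := ((eU.symm j).2 _ (hne j i)).symm
    simp [graphJoin, this]
  · rw [hφr, hφr]
    have : G.Adj (e.symm i) (e.symm j) ↔ H.Adj i j := e.symm.map_adj_iff
    simp [graphJoin, this]

end Universal

/-! ### The Petersen graph and the main result -/

/-- The two-element subsets of a five-element set, in the order of the vertices of
`Pattern.petersen`. -/
def petersenVertex : Fin 10 → {s : Finset (Fin 5) // s.card = 2} :=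
  ![⟨{0, 1}, rfl⟩, ⟨{2, 3}, rfl⟩, ⟨{0, 4}, rfl⟩, ⟨{1, 2}, rfl⟩, ⟨{0, 3}, rfl⟩, ⟨{2, 4}, rfl⟩,
    ⟨{3, 4}, rfl⟩, ⟨{0, 2}, rfl⟩, ⟨{1, 4}, rfl⟩, ⟨{1, 3}, rfl⟩]

theorem petersenVertex_bijective : Function.Bijective petersenVertex :=
  (Fintype.bijective_iff_injective_and_card _).mpr ⟨by decide, by decide⟩

theorem testBit_petersen (i j : Fin 10) : Pattern.petersen.testBit (16 * i + j) = true ↔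
    petersenGraph.Adj (petersenVertex i) (petersenVertex j) := by
  have key : ∀ i j : Fin 10, Pattern.petersen.testBit (16 * i + j) = true ↔
      Disjoint (petersenVertex i).1 (petersenVertex j).1 := by
    decide +kernel
  exact key i j

/-- A connected sparse graph with an edge is the Petersen graph. -/
theorem IsSparse.nonempty_iso_petersenGraph {V : Type*} {G : SimpleGraph V} (hG : IsSparse G)
    (hconn : ∀ A : Set V, A.Nonempty → (∃ q, q ∉ A) → ∃ a ∈ A, ∃ b, b ∉ A ∧ G.Adj a b) {a b : V}
    (hab : G.Adj a b) : Nonempty (G ≃g petersenGraph) := by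
  obtain ⟨f, hf⟩ := Pattern.exists_realizes_petersen hG hab
  have hbij : Function.Bijective fun i : Fin 10 => f i := by
    refine ⟨fun i j hij => Fin.ext (hf.inj i i.2 j j.2 hij), fun q => ?_⟩
    by_contra hq
    obtain ⟨-, ⟨i, rfl⟩, x, hx, hadj⟩ :=
      hconn (Set.range fun i : Fin 10 => f i) ⟨_, Set.mem_range_self 0⟩ ⟨q, hq⟩
    exact hf.not_adj_petersen hG (fun i hi h => hx ⟨⟨i, hi⟩, h.symm⟩) i i.2 hadj.symm
  let e := (Equiv.ofBijective _ hbij).symm.trans (Equiv.ofBijective _ petersenVertex_bijective)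
  refine ⟨SimpleGraph.Iso.symm ⟨e.symm, fun {s t} => ?_⟩⟩
  obtain ⟨i, rfl⟩ := petersenVertex_bijective.2 s
  obtain ⟨j, rfl⟩ := petersenVertex_bijective.2 t
  have he : ∀ i, e.symm (petersenVertex i) = f i := fun i => by
    rw [Equiv.symm_apply_eq]
    simp only [e, Equiv.trans_apply]
    rw [show (Equiv.ofBijective _ hbij).symm (f i) = i from
      (Equiv.symm_apply_eq _).mpr rfl]
    rfl
  rw [he, he, ← hf.adj i i.2 j j.2, testBit_petersen]

theorem theorem2 {V : Type*} [Fintype V] (G : SimpleGraph V) [DecidableRel G.Adj]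
    (hconn : G.Connected)
    (hP7 : InducedFree G (SimpleGraph.pathGraph 7))
    (hC4 : InducedFree G (SimpleGraph.cycleGraph 4))
    (hkite : InducedFree G kite)
    (hcut : ¬ ∃ K : Set V, IsCliqueCutset G K)
    (hdeg : G.cliqueNum + 1 ≤ G.minDegree) :
    ∃ ℓ : ℕ,
      Nonempty (G ≃g graphJoin (⊤ : SimpleGraph (Fin ℓ)) petersenGraph) ∨
      Nonempty (G ≃g graphJoin (⊤ : SimpleGraph (Fin ℓ)) graphF) := by
  have := hconn.nonempty
  have hG := IsKiteFreeAtom.of_free hconn hC4 hkite hcut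
  obtain ⟨a, b, hab⟩ := exists_core_adj hdeg
  obtain ⟨e⟩ := (hG.isSparse_core hP7 hdeg).nonempty_iso_petersenGraph
    (fun A hA ⟨q, hq⟩ => by
      -- The empty clique does not separate the graph.
      obtain ⟨a, ha, b, hb, -, hab⟩ := hG.core.exists_edge ∅ A (by simp) hA (by simp)
        ⟨q, hq, by simp⟩
      exact ⟨a, ha, b, hb, hab⟩) hab
  obtain ⟨ℓ, hℓ⟩ := exists_iso_graphJoin e
  exact ⟨ℓ, Or.inl hℓ⟩
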